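/- **Lower bound for overlapping tomography with joint measurements.** Let $1\le k\le n$ be integers (the case $k=1$ included). A procedure for $k$-qubit overlapping tomography of $n$-qubit states from $m$ copies consists of an arbitrary joint POVM on $(\mathbb{C}^2)^{\otimes nm}$, applied to $\rho^{\otimes m}$, and of an estimate (an arbitrary $2^k\times 2^k$ complex matrix) $\tilde\rho_S$ for every set $S$ of $k$ qubits, which is a function of the measurement outcome. It solves the problem with error $\epsilon$ and confidence $1-\delta$ if for every $n$-qubit density matrix $\rho$, with probability at least $1-\delta$ one has $\|\rho_S-\tilde\rho_S\|_1\le\epsilon$ simultaneously for all $S$ with $|S|=k$, where $\rho_S$ is the reduced density matrix of $\rho$ on $S$ and $\|\cdot\|_1$ is the trace norm. Then $\Omega(\log(n/\delta)/\epsilon^2)$ copies are necessary: for all constants $\epsilon_0<1$ and $\delta_0<1/2$ there is a constant $c>0$, depending only on $\epsilon_0$ and $\delta_0$, such that for all $1\le k\le n$, all $0<\epsilon\le\epsilon_0$ and all $0<\delta\le\delta_0$, every procedure that solves $k$-qubit overlapping tomography of $n$-qubit states from $m$ copies with error $\epsilon$ and confidence $1-\delta$ satisfies $$ m\;\ge\;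 c\,\frac{\log(n/\delta)}{\epsilon^2}. $$ -/

import Mathlib

open scoped Matrix ComplexOrder

noncomputable section

namespace OverlappingTomography

/-- Labels of the computational basis of a register of qubits indexed by `ι`. -/
abbrev Bits (ι : Type*) : Type _ := ι → Fin 2

/-- A density matrix: positive semidefinite of trace one. -/
structure IsState {d : Type*} [Fintype d] (ρ : Matrix d d ℂ) : Prop where
  posSemidef : ρ.PosSemidef
  trace_eq_one : ρ.trace = 1

/-- The `m`-fold tensor power `ρ ⊗ ⋯ ⊗ ρ`, describing `m` independent copies of `ρ`. -/
def tensorPower {d : Type*} (m : ℕ) (ρ : Matrix d d ℂ) : Matrix (Fin m → d) (Fin m → d) ℂ :=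
  Matrix.of fun x y => ∏ j, ρ (x j) (y j)

/-- The bit string on `Fin n` that agrees with `a` on `S` and with `c` off `S`. -/
def glue {n : ℕ} (S : Finset (Fin n)) (a : Bits S) (c : Bits {i : Fin n // i ∉ S}) :
    Bits (Fin n) :=
  fun i => if h : i ∈ S then a ⟨i, h⟩ else c ⟨i, h⟩

/-- The reduced density matrix of `ρ` on the qubits in `S`: the partial trace of `ρ` over the
qubits outside `S`. -/
def reduced {n : ℕ} (S : Finset (Fin n)) (ρ : Matrix (Bits (Fin n)) (Bits (Fin n)) ℂ) :
    Matrix (Bits S) (Bits S) ℂ :=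
  Matrix.of fun a b => ∑ c : Bits {i : Fin n // i ∉ S}, ρ (glue S a c) (glue S b c)

/-- The trace norm `‖A‖₁ = Tr √(A† A)`: the sum of the singular values of `A`. -/
def traceNorm {d : Type*} [Fintype d] [DecidableEq d] (A : Matrix d d ℂ) : ℝ :=
  ∑ i, √((Matrix.isHermitian_conjTranspose_mul_self A).eigenvalues i)

/-- A positive-operator valued measure on `ℂ^d` with outcomes in the measurable space `Ω`: a
countably additive assignment of positive semidefinite matrices to the measurable subsets of `Ω`
with total value the identity. (For a countable `Ω` in which all subsets are measurable this is
a family of positive semidefinite matrices that sums to the identity.) -/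
structure POVM (d : Type*) [Fintype d] [DecidableEq d] (Ω : Type*) [MeasurableSpace Ω] where
  effect : MeasureTheory.VectorMeasure Ω (Matrix d d ℂ)
  posSemidef : ∀ s, MeasurableSet s → (effect s).PosSemidef
  univ_eq_one : effect Set.univ = 1

/-- Born's rule: the probability that measuring the state `ρ` gives an outcome in `s`. -/
def POVM.prob {d : Type*} [Fintype d] [DecidableEq d] {Ω : Type*} [MeasurableSpace Ω]
    (M : POVM d Ω) (ρ : Matrix d d ℂ) (s : Set Ω) : ℝ :=
  (M.effect s * ρ).trace.re

/-- A procedure for `k`-qubit overlapping tomography of `n`-qubit states from `m` copies, in its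
most general form: a joint measurement of all `m` copies, and an estimate of the reduced density
matrix on each set of `k` qubits, which is a function of the outcome. The estimates are arbitrary
matrices. -/
structure Procedure (n k m : ℕ) (Ω : Type*) [MeasurableSpace Ω] where
  measurement : POVM (Fin m → Bits (Fin n)) Ω
  estimate : Ω → ∀ S : Finset (Fin n), S.card = k → Matrix (Bits S) (Bits S) ℂ

/-- The outcomes for which all estimates are within `ε` in trace norm of the reduced density
matrices of `ρ`. -/
def Procedure.success {n k m : ℕ} {Ω : Type*} [MeasurableSpace Ω] (A : Procedure n k m Ω)
    (ε : ℝ) (ρ : Matrix (Bits (Fin n)) (Bits (Fin n)) ℂ) : Set Ω :=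
  {ω | ∀ (S : Finset (Fin n)) (hS : S.card = k),
    traceNorm (reduced S ρ - A.estimate ω S hS) ≤ ε}

/-- The procedure solves overlapping tomography with error `ε` and confidence `1 - δ`: whatever
the unknown state `ρ` is, with probability at least `1 - δ` all estimates are `ε`-close. -/
def Procedure.Solves {n k m : ℕ} {Ω : Type*} [MeasurableSpace Ω] (A : Procedure n k m Ω)
    (ε δ : ℝ) : Prop :=
  ∀ ρ : Matrix (Bits (Fin n)) (Bits (Fin n)) ℂ, IsState ρ →
    MeasurableSet (A.success ε ρ) ∧
      1 - δ ≤ A.measurement.prob (tensorPower m ρ) (A.success ε ρ)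

end OverlappingTomography

end

namespace OverlappingTomography

/-! ### A lower bound for the trace norm -/

/-! Tomography is at least as hard as learning `n` hidden bits. Each bit string `b` is encoded in a
diagonal product state with biases `r` slightly above `ε`. Flipping one bit moves the expectation of
`Z` on that qubit by `2 * r > 2 * ε`, so successful estimates determine `b`
(`Procedure.disjoint_success`).

All these states are diagonal, so even a joint measurement is only a randomized classical guess. For
uniform `b` its success probability is at most `(T / 2) ^ n`, where `T / 2` is the optimal
probability of guessing one bit from `m` samples (`Procedure.Solves.le_maxLikelihoodSum_pow`).

Hence the error `q = 1 - T / 2` per bit is `O(δ / n)`, whereas Cauchy-Schwarz forces `(1 - r ^ 2) ^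
m ≤ 4 * q` (`one_sub_sq_pow_le`). Logarithms then bound `m` from below. -/

lemma sum_norm_sq_mul_eigenvectorUnitary {d : Type*} [Fintype d] [DecidableEq d]
    (A : Matrix d d ℂ) (i : d) :
    ∑ a, ‖(A * ((Matrix.isHermitian_conjTranspose_mul_self A).eigenvectorUnitary :
      Matrix d d ℂ)) a i‖ ^ 2 = (Matrix.isHermitian_conjTranspose_mul_self A).eigenvalues i := by
  set hA := Matrix.isHermitian_conjTranspose_mul_self A
  set V : Matrix d d ℂ := hA.eigenvectorUnitary.1 with hV
  have hdiag : (A * V)ᴴ * (A * V) = Matrix.diagonal (RCLike.ofReal ∘ hA.eigenvalues) := by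
    have h := hA.conjStarAlgAut_star_eigenvectorUnitary
    rw [Unitary.conjStarAlgAut_apply] at h
    rw [← h, Matrix.conjTranspose_mul]
    simp [hV, Matrix.star_eq_conjTranspose, Matrix.mul_assoc]
  have h := congrFun (congrFun hdiag i) i
  rw [Matrix.mul_apply, Matrix.diagonal_apply_eq] at h
  have h' : ((∑ a, ‖(A * V) a i‖ ^ 2 : ℝ) : ℂ) = (hA.eigenvalues i : ℂ) := by
    rw [Complex.ofReal_sum]
    refine Eq.trans (Finset.sum_congr rfl fun a _ => ?_) h
    rw [Matrix.conjTranspose_apply, Complex.star_def, Complex.conj_mul']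
    push_cast
    rfl
  exact_mod_cast h'

/-- Pairing a matrix with a diagonal contraction is bounded by the trace norm. -/
lemma norm_sum_mul_diag_le_traceNorm {d : Type*} [Fintype d] [DecidableEq d]
    (A : Matrix d d ℂ) (s : d → ℂ) (hs : ∀ a, ‖s a‖ ≤ 1) :
    ‖∑ a, s a * A a a‖ ≤ traceNorm A := by
  set hA := Matrix.isHermitian_conjTranspose_mul_self A
  set V : Matrix d d ℂ := hA.eigenvectorUnitary.1 with hV
  have hVV : V * Vᴴ = 1 := by
    have := Unitary.coe_mul_star_self hA.eigenvectorUnitary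
    simpa [hV, Matrix.star_eq_conjTranspose] using this
  have hVV' : Vᴴ * V = 1 := by
    have := Unitary.coe_star_mul_self hA.eigenvectorUnitary
    simpa [hV, Matrix.star_eq_conjTranspose] using this
  have hcol : ∀ i, ∑ a, ‖V a i‖ ^ 2 = 1 := by
    intro i
    have h := congrFun (congrFun hVV' i) i
    rw [Matrix.mul_apply, Matrix.one_apply_eq] at h
    have h' : ((∑ a, ‖V a i‖ ^ 2 : ℝ) : ℂ) = 1 := by
      rw [Complex.ofReal_sum]
      refine Eq.trans (Finset.sum_congr rfl fun a _ => ?_) h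
      rw [Matrix.conjTranspose_apply, Complex.star_def, Complex.conj_mul']
      push_cast
      rfl
    exact_mod_cast h'
  have hexp : ∀ a, A a a = ∑ i, (A * V) a i * star (V a i) := by
    intro a
    have : A = (A * V) * Vᴴ := by rw [Matrix.mul_assoc, hVV, Matrix.mul_one]
    conv_lhs => rw [this, Matrix.mul_apply]
    rfl
  calc ‖∑ a, s a * A a a‖ ≤ ∑ a, ‖s a * A a a‖ := norm_sum_le _ _
    _ ≤ ∑ a, ∑ i, ‖(A * V) a i‖ * ‖V a i‖ := by
      refine Finset.sum_le_sum fun a _ => ?_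
      calc ‖s a * A a a‖ ≤ 1 * ‖A a a‖ := by
            rw [norm_mul]
            exact mul_le_mul_of_nonneg_right (hs a) (norm_nonneg _)
        _ = ‖∑ i, (A * V) a i * star (V a i)‖ := by rw [one_mul, hexp a]
        _ ≤ ∑ i, ‖(A * V) a i * star (V a i)‖ := norm_sum_le _ _
        _ = ∑ i, ‖(A * V) a i‖ * ‖V a i‖ := by simp only [norm_mul, norm_star]
    _ = ∑ i, ∑ a, ‖(A * V) a i‖ * ‖V a i‖ := Finset.sum_comm
    _ ≤ traceNorm A := by
      refine Finset.sum_le_sum fun i _ => ?_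
      -- Cauchy-Schwarz in each column: the columns of `V` are unit vectors, those of `A * V` have
      -- the singular values as norms.
      refine (Real.sum_mul_le_sqrt_mul_sqrt _ _ _).trans ?_
      rw [hcol, Real.sqrt_one, mul_one, sum_norm_sq_mul_eigenvectorUnitary]

/-! ### Product states of biased classical bits -/

/-- The distribution of a bit that takes the value `s` with probability `(1 + r) / 2`. -/
noncomputable def bias (r : ℝ) (s t : Fin 2) : ℝ := if s = t then (1 + r) / 2 else (1 - r) / 2

/-- The eigenvalues `±1` of the Pauli matrix `Z`. -/
def zSign (t : Fin 2) : ℝ := if t = 0 then 1 else -1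

lemma bias_nonneg {r : ℝ} (h0 : 0 ≤ r) (h1 : r ≤ 1) (s t : Fin 2) : 0 ≤ bias r s t := by
  unfold bias
  split_ifs <;> linarith

lemma sum_bias (r : ℝ) (s : Fin 2) : ∑ t, bias r s t = 1 := by
  fin_cases s <;> simp [bias, Fin.sum_univ_two] <;> ring

lemma sum_zSign_mul_bias (r : ℝ) (s : Fin 2) : ∑ t, zSign t * bias r s t = zSign s * r := by
  fin_cases s <;> simp [bias, zSign, Fin.sum_univ_two] <;> ring

lemma bias_mul_bias (r : ℝ) (t : Fin 2) : bias r 0 t * bias r 1 t = (1 - r ^ 2) / 4 := by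
  fin_cases t <;> simp [bias] <;> ring

/-- The classical product state in which the `i`-th bit is biased towards `b i`. -/
noncomputable def productState {n : ℕ} (r : ℝ) (b : Bits (Fin n)) :
    Matrix (Bits (Fin n)) (Bits (Fin n)) ℂ :=
  Matrix.diagonal fun z => ((∏ i, bias r (b i) (z i) : ℝ) : ℂ)

lemma isState_productState {n : ℕ} {r : ℝ} (h0 : 0 ≤ r) (h1 : r ≤ 1) (b : Bits (Fin n)) :
    IsState (productState r b) where
  posSemidef := by
    refine Matrix.PosSemidef.diagonal fun z => ?_
    exact Complex.zero_le_real.mpr (Finset.prod_nonneg fun i _ => bias_nonneg h0 h1 _ _)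
  trace_eq_one := by
    rw [productState, Matrix.trace_diagonal, ← Complex.ofReal_sum, ← Fintype.prod_sum]
    simp only [sum_bias, Finset.prod_const_one, Complex.ofReal_one]

lemma tensorPower_productState {n m : ℕ} (r : ℝ) (b : Bits (Fin n)) :
    tensorPower m (productState r b) =
      Matrix.diagonal fun x => ((∏ j, ∏ i, bias r (b i) (x j i) : ℝ) : ℂ) := by
  ext x y
  simp only [tensorPower, productState, Matrix.of_apply, Matrix.diagonal_apply]
  split_ifs with h
  · subst h
    simp
  · obtain ⟨j, hj⟩ := Function.ne_iff.mp h
    exact Finset.prod_eq_zero (Finset.mem_univ j) (if_neg hj)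

lemma sum_glue {n : ℕ} {M : Type*} [AddCommMonoid M] (S : Finset (Fin n)) (f : Bits (Fin n) → M) :
    ∑ a, ∑ c, f (glue S a c) = ∑ z, f z := by
  rw [← Fintype.sum_prod_type' (f := fun a c => f (glue S a c))]
  exact (Fintype.sum_equiv (Equiv.piEquivPiSubtypeProd (· ∈ S) fun _ => Fin 2) _ _ fun z => by
    congr 1
    ext i
    simp [glue, Equiv.piEquivPiSubtypeProd]).symm

lemma sum_zSign_mul_reduced_productState {n : ℕ} (r : ℝ) (b : Bits (Fin n)) (S : Finset (Fin n))
    {i : Fin n} (hi : i ∈ S) :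
    ∑ a, (zSign (a ⟨i, hi⟩) : ℂ) * reduced S (productState r b) a a = (zSign (b i) * r : ℝ) := by
  have hglue : ∀ (a : Bits S) c, a ⟨i, hi⟩ = glue S a c i := fun a c => by simp [glue, hi]
  -- Absorbing the sign into the `i`-th factor lets the sum over `z` factorize over the qubits.
  have hsplit : ∀ z : Bits (Fin n), zSign (z i) * ∏ j, bias r (b j) (z j) =
      ∏ j, (if j = i then zSign (z j) else 1) * bias r (b j) (z j) := fun z => by
    rw [Finset.prod_mul_distrib, Finset.prod_ite_eq']
    simp
  calc _ = ∑ a, ∑ c, (zSign (glue S a c i) : ℂ) *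
        productState r b (glue S a c) (glue S a c) := by
        refine Finset.sum_congr rfl fun a _ => ?_
        rw [reduced, Matrix.of_apply, Finset.mul_sum]
        exact Finset.sum_congr rfl fun c _ => by rw [hglue a c]
    _ = ∑ z, (zSign (z i) : ℂ) * productState r b z z :=
        sum_glue S fun z => (zSign (z i) : ℂ) * productState r b z z
    _ = ((∑ z : Bits (Fin n), zSign (z i) * ∏ j, bias r (b j) (z j) : ℝ) : ℂ) := by
        simp [productState]
    _ = _ := by
        congr 1
        simp_rw [hsplit]
        rw [← Fintype.prod_sum fun j t => (if j = i then zSign t else 1) * bias r (b j) t]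
        rw [Finset.prod_eq_single i]
        · simp only [if_true, sum_zSign_mul_bias]
        · intro j _ hj
          simp only [hj, if_false, one_mul, sum_bias]
        · simp

lemma abs_zSign_sub_zSign {s t : Fin 2} (h : s ≠ t) : |zSign s - zSign t| = 2 := by
  fin_cases s <;> fin_cases t <;> simp_all [zSign] <;> norm_num

lemma abs_zSign (t : Fin 2) : |zSign t| = 1 := by
  unfold zSign
  split_ifs <;> simp

/-- No outcome is a success for two different product states of large bias. -/
lemma Procedure.disjoint_success {n k m : ℕ} {Ω : Type*} [MeasurableSpace Ω]
    (A : Procedure n k m Ω) (hk : 1 ≤ k) (hkn : k ≤ n) {ε r : ℝ} (hr : 0 ≤ r) (hεr : ε < r)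
    {b b' : Bits (Fin n)} (hb : b ≠ b') :
    Disjoint (A.success ε (productState r b)) (A.success ε (productState r b')) := by
  rw [Set.disjoint_left]
  intro ω h h'
  obtain ⟨i, hi⟩ := Function.ne_iff.mp hb
  obtain ⟨S, hiS, -, hS⟩ := Finset.exists_subsuperset_card_eq
    (Finset.subset_univ ({i} : Finset (Fin n))) (by simpa using hk) (by simpa using hkn)
  rw [Finset.singleton_subset_iff] at hiS
  have key : ∀ c : Bits (Fin n), ω ∈ A.success ε (productState r c) →
      ‖((zSign (c i) * r : ℝ) : ℂ) - ∑ a, (zSign (a ⟨i, hiS⟩) : ℂ) * A.estimate ω S hS a a‖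
        ≤ ε := by
    intro c hc
    refine le_trans ?_ (hc S hS)
    rw [← sum_zSign_mul_reduced_productState r c S hiS, ← Finset.sum_sub_distrib]
    simp_rw [← mul_sub]
    refine norm_sum_mul_diag_le_traceNorm (reduced S (productState r c) - A.estimate ω S hS)
      (fun a => (zSign (a ⟨i, hiS⟩) : ℂ)) fun a => ?_
    rw [Complex.norm_real, Real.norm_eq_abs, abs_zSign]
  have h1 := norm_sub_le_norm_sub_add_norm_sub ((zSign (b i) * r : ℝ) : ℂ)
    (∑ a, (zSign (a ⟨i, hiS⟩) : ℂ) * A.estimate ω S hS a a) ((zSign (b' i) * r : ℝ) : ℂ)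
  rw [norm_sub_rev (∑ a, _), ← Complex.ofReal_sub, Complex.norm_real, Real.norm_eq_abs,
    ← sub_mul, abs_mul, abs_zSign_sub_zSign hi, abs_of_nonneg hr] at h1
  linarith [key b h, key b' h']


/-! ### The success probability of an optimal discrimination -/

/-- The diagonal entries of the effects of pairwise disjoint events form a sub-probability. -/
lemma POVM.sum_re_diag_effect_le_one {d ι : Type*} [Fintype d] [DecidableEq d] [Fintype ι]
    {Ω : Type*} [MeasurableSpace Ω] (M : POVM d Ω) (s : ι → Set Ω)
    (hs : ∀ b, MeasurableSet (s b)) (hd : Pairwise (Function.onFun Disjoint s)) (x : d) :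
    ∑ b, (M.effect (s b) x x).re ≤ 1 := by
  have hU : MeasurableSet (⋃ b, s b) := MeasurableSet.iUnion hs
  have hsum : M.effect (⋃ b, s b) = ∑ b, M.effect (s b) := by
    rw [M.effect.of_disjoint_iUnion hs hd, tsum_fintype]
  have hcompl : M.effect (⋃ b, s b)ᶜ = 1 - ∑ b, M.effect (s b) := by
    rw [M.effect.of_compl hU, M.univ_eq_one, hsum]
  have hpos := (Complex.le_def.mp ((M.posSemidef _ hU.compl).diag_nonneg (i := x))).1
  rw [hcompl, Matrix.sub_apply, Matrix.one_apply_eq, Matrix.sum_apply] at hpos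
  simpa using hpos

lemma POVM.prob_diagonal {d : Type*} [Fintype d] [DecidableEq d] {Ω : Type*} [MeasurableSpace Ω]
    (M : POVM d Ω) (p : d → ℝ) (s : Set Ω) :
    M.prob (Matrix.diagonal fun x => (p x : ℂ)) s = ∑ x, (M.effect s x x).re * p x := by
  simp [POVM.prob, Matrix.trace, Matrix.mul_diagonal]

/-- The likelihood of the larger of the two biases, summed over all strings of `m` bits. -/
noncomputable def maxLikelihoodSum (m : ℕ) (r : ℝ) : ℝ :=
  ∑ y : Fin m → Fin 2, max (∏ j, bias r 0 (y j)) (∏ j, bias r 1 (y j))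

lemma prod_bias_le_max (m : ℕ) (r : ℝ) (s : Fin 2) (y : Fin m → Fin 2) :
    ∏ j, bias r s (y j) ≤ max (∏ j, bias r 0 (y j)) (∏ j, bias r 1 (y j)) := by
  fin_cases s
  · exact le_max_left _ _
  · exact le_max_right _ _

/-- Solving overlapping tomography identifies `n` independent biases from `m` samples of each. -/
lemma Procedure.Solves.le_maxLikelihoodSum_pow {n k m : ℕ} {Ω : Type*} [MeasurableSpace Ω]
    {A : Procedure n k m Ω} {ε δ r : ℝ} (hA : A.Solves ε δ) (hk : 1 ≤ k) (hkn : k ≤ n)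
    (hr : 0 ≤ r) (hr1 : r ≤ 1) (hεr : ε < r) :
    2 ^ n * (1 - δ) ≤ maxLikelihoodSum m r ^ n := by
  set s : Bits (Fin n) → Set Ω := fun b => A.success ε (productState r b)
  have hs : ∀ b, MeasurableSet (s b) := fun b => (hA _ (isState_productState hr hr1 b)).1
  have hd : Pairwise (Function.onFun Disjoint s) := fun b b' hb =>
    A.disjoint_success hk hkn hr hεr hb
  -- The maximum over all `b` of the likelihood of `x`, so the dependence on `b` remains only in the
  -- effects.
  set p : (Fin m → Bits (Fin n)) → ℝ := fun x =>
    ∏ i, max (∏ j, bias r 0 (x j i)) (∏ j, bias r 1 (x j i))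
  have hp0 : ∀ x, 0 ≤ p x := fun x => Finset.prod_nonneg fun i _ =>
    le_max_of_le_left (Finset.prod_nonneg fun j _ => bias_nonneg hr hr1 _ _)
  have hprob : ∀ b, 1 - δ ≤ ∑ x, (A.measurement.effect (s b) x x).re * p x := by
    intro b
    have h := (hA _ (isState_productState hr hr1 b)).2
    rw [tensorPower_productState, POVM.prob_diagonal] at h
    refine h.trans (Finset.sum_le_sum fun x _ => mul_le_mul_of_nonneg_left ?_ ?_)
    · rw [Finset.prod_comm]
      exact Finset.prod_le_prod
        (fun i _ => Finset.prod_nonneg fun j _ => bias_nonneg hr hr1 _ _)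
        fun i _ => prod_bias_le_max m r (b i) fun j => x j i
    · exact (Complex.le_def.mp ((A.measurement.posSemidef _ (hs b)).diag_nonneg (i := x))).1
  calc 2 ^ n * (1 - δ) = ∑ _b : Bits (Fin n), (1 - δ) := by simp [mul_sub]
    _ ≤ ∑ b, ∑ x, (A.measurement.effect (s b) x x).re * p x :=
        Finset.sum_le_sum fun b _ => hprob b
    _ = ∑ x, (∑ b, (A.measurement.effect (s b) x x).re) * p x := by
        rw [Finset.sum_comm]
        simp_rw [Finset.sum_mul]
    _ ≤ ∑ x, p x := Finset.sum_le_sum fun x _ =>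
        mul_le_of_le_one_left (hp0 x) (A.measurement.sum_re_diag_effect_le_one s hs hd x)
    _ = ∑ z : Fin n → Fin m → Fin 2,
          ∏ i, max (∏ j, bias r 0 (z i j)) (∏ j, bias r 1 (z i j)) :=
        Fintype.sum_equiv (Equiv.piComm fun _ _ => Fin 2) _ _ fun x => rfl
    _ = maxLikelihoodSum m r ^ n := by
        rw [← Fintype.prod_sum fun (_ : Fin n) (y : Fin m → Fin 2) =>
          max (∏ j, bias r 0 (y j)) (∏ j, bias r 1 (y j))]
        simp [maxLikelihoodSum]

lemma sum_prod_bias (m : ℕ) (r : ℝ) (s : Fin 2) :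
    ∑ y : Fin m → Fin 2, ∏ j, bias r s (y j) = 1 := by
  rw [← Fintype.prod_sum fun (_ : Fin m) t => bias r s t]
  simp only [sum_bias, Finset.prod_const_one]

lemma sum_min_prod_bias (m : ℕ) (r : ℝ) :
    ∑ y : Fin m → Fin 2, min (∏ j, bias r 0 (y j)) (∏ j, bias r 1 (y j)) =
      2 - maxLikelihoodSum m r := by
  rw [eq_sub_iff_add_eq, maxLikelihoodSum, ← Finset.sum_add_distrib]
  simp_rw [min_add_max]
  rw [Finset.sum_add_distrib, sum_prod_bias, sum_prod_bias]
  norm_num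

lemma maxLikelihoodSum_nonneg (m : ℕ) {r : ℝ} (hr : 0 ≤ r) (hr1 : r ≤ 1) :
    0 ≤ maxLikelihoodSum m r :=
  Finset.sum_nonneg fun _ _ =>
    le_max_of_le_left (Finset.prod_nonneg fun _ _ => bias_nonneg hr hr1 _ _)

lemma maxLikelihoodSum_le_two (m : ℕ) {r : ℝ} (hr : 0 ≤ r) (hr1 : r ≤ 1) :
    maxLikelihoodSum m r ≤ 2 := by
  rw [← sub_nonneg, ← sum_min_prod_bias]
  exact Finset.sum_nonneg fun _ _ =>
    le_min (Finset.prod_nonneg fun _ _ => bias_nonneg hr hr1 _ _)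
      (Finset.prod_nonneg fun _ _ => bias_nonneg hr hr1 _ _)

/-- The fidelity bound on the total variation distance, for `m` samples of the two biases. -/
lemma one_sub_sq_pow_le (m : ℕ) {r : ℝ} (hr : 0 ≤ r) (hr1 : r ≤ 1) :
    (1 - r ^ 2) ^ m ≤ maxLikelihoodSum m r * (2 - maxLikelihoodSum m r) := by
  have h0 : 0 ≤ 1 - r ^ 2 := by nlinarith
  have hprod : ∀ y : Fin m → Fin 2,
      (∏ j, bias r 0 (y j)) * ∏ j, bias r 1 (y j) = ((1 - r ^ 2) / 4) ^ m := fun y => by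
    rw [← Finset.prod_mul_distrib]
    simp [bias_mul_bias, div_pow]
  -- Max times min is the product of the two likelihoods, which is the same for every string `y`.
  have hcs := Finset.sum_sq_le_sum_mul_sum_of_sq_le_mul (Finset.univ : Finset (Fin m → Fin 2))
    (r := fun _ => √(1 - r ^ 2) ^ m / 2 ^ m)
    (f := fun y => max (∏ j, bias r 0 (y j)) (∏ j, bias r 1 (y j)))
    (g := fun y => min (∏ j, bias r 0 (y j)) (∏ j, bias r 1 (y j)))
    (fun y _ => le_max_of_le_left (Finset.prod_nonneg fun _ _ => bias_nonneg hr hr1 _ _))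
    (fun y _ => le_min (Finset.prod_nonneg fun _ _ => bias_nonneg hr hr1 _ _)
      (Finset.prod_nonneg fun _ _ => bias_nonneg hr hr1 _ _))
    (fun y _ => le_of_eq <| by
      rw [mul_comm, min_mul_max, hprod, ← div_pow, ← pow_mul, mul_comm m 2, pow_mul, div_pow,
        Real.sq_sqrt h0, show (2 : ℝ) ^ 2 = 4 by norm_num])
  rw [sum_min_prod_bias] at hcs
  refine le_trans (le_of_eq ?_) hcs
  simp only [Finset.sum_const, Finset.card_univ, Fintype.card_pi_const, Fintype.card_fin,
    nsmul_eq_mul, Nat.cast_pow, Nat.cast_ofNat]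
  rw [mul_div_cancel₀ _ (by positivity), ← pow_mul, mul_comm m 2, pow_mul, Real.sq_sqrt h0]

/-! ### The number of samples -/

/-- Guessing even one bit better than chance needs order `1 / r ^ 2` samples. This later absorbs the
additive `log 8` of `log_sub_log_le`. -/
lemma one_sub_two_mul_sq_le {n m : ℕ} (hn : 1 ≤ n) {r T δ δ₀ : ℝ} (hr1 : r ≤ 1) (hr : 0 ≤ r)
    (hT0 : 0 ≤ T) (hT2 : T ≤ 2) (hfid : (1 - r ^ 2) ^ m ≤ T * (2 - T))
    (hδδ₀ : δ ≤ δ₀) (hδ₀ : δ₀ < 1 / 2) (hpow : 2 ^ n * (1 - δ) ≤ T ^ n) :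
    (1 - 2 * δ₀) ^ 2 ≤ m * r ^ 2 := by
  have hT : 1 - δ ≤ T / 2 := by
    have h : 1 - δ ≤ (T / 2) ^ n := by
      rw [div_pow, le_div_iff₀ (by positivity)]
      linarith
    exact h.trans (pow_le_of_le_one (by linarith) (by linarith) (by omega))
  have hbern := one_add_mul_le_pow (a := -r ^ 2) (by nlinarith) m
  rw [← sub_eq_add_neg] at hbern
  -- `(T - 1) ^ 2 = 1 - T * (2 - T) ≤ m * r ^ 2`, and `T - 1 ≥ 1 - 2 * δ₀ > 0`.
  nlinarith

/-- All `n` bits must be right at once, so each may fail only with probability of order `δ / n`;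
this is the source of the factor `log (n / δ)`. -/
lemma log_sub_log_le {n m : ℕ} (hn : 1 ≤ n) {r T δ : ℝ} (hr1 : r < 1) (hr : 0 ≤ r)
    (hT0 : 0 ≤ T) (hT2 : T ≤ 2) (hfid : (1 - r ^ 2) ^ m ≤ T * (2 - T))
    (hδ : 0 < δ) (hδ2 : δ < 1 / 2) (hpow : 2 ^ n * (1 - δ) ≤ T ^ n) :
    Real.log (n / δ) - Real.log 8 ≤ m * (r ^ 2 / (1 - r ^ 2)) := by
  have hn0 : (0 : ℝ) < n := by exact_mod_cast hn
  have hu : 0 < 1 - r ^ 2 := by nlinarith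
  set q := 1 - T / 2 with hq
  have hTq : T = 2 * (1 - q) := by rw [hq]; ring
  have hq0 : 0 ≤ q := by linarith
  have hq1 : q ≤ 1 := by linarith
  -- Bernoulli is applied to `(1 + q) ^ n`, and `(1 - q ^ 2) ^ n ≤ 1` transfers it to `(1 - q) ^ n`.
  have hnq : n * q ≤ 2 * δ := by
    have h1 : 1 - δ ≤ (1 - q) ^ n := by
      rw [hTq, mul_pow] at hpow
      exact le_of_mul_le_mul_left hpow (by positivity)
    have h2 : 1 + n * q ≤ (1 + q) ^ n := one_add_mul_le_pow (by linarith) n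
    have h3 : (1 - q) ^ n * (1 + q) ^ n ≤ 1 := by
      rw [← mul_pow]
      exact pow_le_one₀ (by nlinarith) (by nlinarith)
    have h4 : (1 - δ) * (1 + n * q) ≤ 1 :=
      (mul_le_mul h1 h2 (by positivity) (by nlinarith [pow_nonneg (sub_nonneg.mpr hq1) n])).trans h3
    have h5 : 0 ≤ n * q := by positivity
    nlinarith
  have hu8 : (1 - r ^ 2) ^ m ≤ 8 * δ / n := by
    rw [le_div_iff₀ hn0]
    have h4q : (1 - r ^ 2) ^ m ≤ 4 * q := by
      rw [hTq] at hfid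
      nlinarith
    nlinarith
  have hlog := Real.log_le_log (pow_pos hu m) hu8
  rw [Real.log_pow, Real.log_div (by positivity) hn0.ne', Real.log_mul (by norm_num) hδ.ne'] at hlog
  rw [Real.log_div hn0.ne' hδ.ne']
  have hinv : -(r ^ 2 / (1 - r ^ 2)) ≤ Real.log (1 - r ^ 2) := by
    refine le_trans (le_of_eq ?_) (Real.one_sub_inv_le_log_of_pos hu)
    field_simp
    ring
  have hm : (0 : ℝ) ≤ m := m.cast_nonneg
  nlinarith [mul_le_mul_of_nonneg_left hinv hm]

end OverlappingTomography

open OverlappingTomography in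
theorem mainTheorem10 (ε₀ δ₀ : ℝ) (hε₀ : ε₀ < 1) (hδ₀ : δ₀ < 1 / 2) :
    ∃ c : ℝ, 0 < c ∧
      ∀ (n k m : ℕ) (ε δ : ℝ), 1 ≤ k → k ≤ n → 0 < ε → ε ≤ ε₀ → 0 < δ → δ ≤ δ₀ →
        ∀ (Ω : Type*) [MeasurableSpace Ω] (A : Procedure n k m Ω), A.Solves ε δ →
          c * Real.log ((n : ℝ) / δ) / ε ^ 2 ≤ (m : ℝ) := by
  rcases le_or_gt ε₀ 0 with hneg | hpos
  · exact ⟨1, one_pos, fun n k m ε δ _ _ h h' => absurd (h.trans_le h') hneg.not_gt⟩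
  -- Chosen so that `r = K * ε` exceeds `ε` yet stays below `R`, the midpoint of `ε₀` and `1`.
  set K : ℝ := (1 + ε₀) / (2 * ε₀) with hK
  have hK1 : 1 < K := by
    rw [hK, one_lt_div (by positivity)]
    linarith
  set R : ℝ := K * ε₀ with hR
  have hR' : R = (1 + ε₀) / 2 := by
    rw [hR, hK]
    field_simp
  have hR1 : R < 1 := by linarith
  have hR0 : 0 < R := by linarith
  have hRsq : 0 < 1 - R ^ 2 := by nlinarith
  set κ : ℝ := K ^ 2 / (1 - R ^ 2) with hκ
  have hκ0 : 0 < κ := by positivity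
  set η : ℝ := (1 - 2 * δ₀) ^ 2 with hη
  have hη0 : 0 < η := by
    have : 0 < 1 - 2 * δ₀ := by linarith
    positivity
  have hlog8 : 0 < Real.log 8 := Real.log_pos (by norm_num)
  refine ⟨1 / (κ * (1 + Real.log 8 / η)), by positivity, ?_⟩
  intro n k m ε δ hk hkn hε hεε₀ hδ hδδ₀ Ω _ A hA
  have hn : 1 ≤ n := hk.trans hkn
  set r : ℝ := K * ε with hr
  have hr0 : 0 < r := by positivity
  have hrR : r ≤ R := mul_le_mul_of_nonneg_left hεε₀ (by positivity)
  have hr1 : r < 1 := hrR.trans_lt hR1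
  have hεr : ε < r := by nlinarith
  have hpow := hA.le_maxLikelihoodSum_pow hk hkn hr0.le hr1.le hεr
  have hT0 := maxLikelihoodSum_nonneg m hr0.le hr1.le
  have hT2 := maxLikelihoodSum_le_two m hr0.le hr1.le
  have hfid := one_sub_sq_pow_le m hr0.le hr1.le
  have h1 : η ≤ m * r ^ 2 :=
    one_sub_two_mul_sq_le hn hr1.le hr0.le hT0 hT2 hfid hδδ₀ hδ₀ hpow
  have h2 := log_sub_log_le hn hr1 hr0.le hT0 hT2 hfid hδ (hδδ₀.trans_lt hδ₀) hpow
  have hm : (0 : ℝ) ≤ m := m.cast_nonneg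
  have hκr : r ^ 2 / (1 - r ^ 2) ≤ κ * ε ^ 2 := by
    have : κ * ε ^ 2 = r ^ 2 / (1 - R ^ 2) := by
      rw [hκ, hr]
      ring
    rw [this]
    gcongr
  have hr2 : r ^ 2 ≤ r ^ 2 / (1 - r ^ 2) := le_div_self (by positivity) (by nlinarith) (by nlinarith)
  set N : ℝ := m * (κ * ε ^ 2) with hN
  have hNη : η ≤ N := h1.trans (mul_le_mul_of_nonneg_left (hr2.trans hκr) hm)
  have hNL : Real.log (n / δ) ≤ N + Real.log 8 := by
    linarith [mul_le_mul_of_nonneg_left hκr hm]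
  have hfin : Real.log (n / δ) ≤ N * (1 + Real.log 8 / η) := by
    -- Since `N ≥ η`, the additive constant costs only a factor.
    have : Real.log 8 ≤ N * (Real.log 8 / η) := by
      rw [mul_div_assoc', le_div_iff₀ hη0, mul_comm N]
      exact mul_le_mul_of_nonneg_left hNη hlog8.le
    linarith
  rw [div_le_iff₀ (by positivity), one_div_mul_eq_div, div_le_iff₀ (by positivity)]
  calc Real.log (n / δ) ≤ N * (1 + Real.log 8 / η) := hfin
    _ = m * ε ^ 2 * (κ * (1 + Real.log 8 / η)) := by
      rw [hN]
      ring
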